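/- Let $G$ be a (finite-dimensional, real) Lie group with Lie algebra $\mathfrak g=T_1G$, acting smoothly from the left on a smooth finite-dimensional manifold $M$, and let $\lambda_*(v,u)=\frac{d}{dt}\big|_{t=0}\exp(tv)\cdot u\in T_uM$ for $v\in\mathfrak g$, $u\in M$, be the infinitesimal generator. Let $\Omega^0(M,\mathfrak g)$ be the real vector space of smooth maps $M\to\mathfrak g$; each $x\in\Omega^0(M,\mathfrak g)$ generates the vector field $\lambda_*(x)(u)=\lambda_*(x(u),u)$ on $M$. For $x,y\in\Omega^0(M,\mathfrak g)$ define, pointwise at $u\in M$, $$[x,y](u)=[x(u),y(u)]_{\mathfrak g},\qquad x\rhd y=\lambda_*(x)(y)\quad\text{(the Lie derivative of $y$ along $\lambda_*(x)$)},$$ where $[\cdot,\cdot]_{\mathfrak g}$ is the Lie bracket on $\mathfrak g$ obtained by identifying $\mathfrak g$ with the right-invariant vector fields on $G$ (with the bracket of vector fields $[\![X,Y]\!](\phi)=X(Y(\phi))-Y(X(\phi))$). Then both operations map $\Omega^0(M,\mathfrak g)\times\Omega^0(M,\mathfrak g)$ bilinearly into $\Omega^0(M,\mathfrak g)$, and $\{\Omega^0(M,\mathfrak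 g),[\cdot,\cdot],\rhd\}$ is a post-Lie algebra, that is, $[\cdot,\cdot]$ is a Lie bracket and, for all $x,y,z$, $$x\rhd[y,z]=[x\rhd y,z]+[y,x\rhd z],\qquad [x,y]\rhd z=a_\rhd(x,y,z)-a_\rhd(y,x,z),$$ where $a_\rhd(x,y,z)=x\rhd(y\rhd z)-(x\rhd y)\rhd z$. Equivalently, if $[\cdot,\cdot]_{\mathfrak g}$ is instead the bracket defined by left-invariant vector fields, and $[\cdot,\cdot]$ is the corresponding pointwise bracket, then $\{\Omega^0(M,\mathfrak g),-[\cdot,\cdot],\rhd\}$ is a post-Lie algebra. -/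

import Mathlib

open scoped Manifold ContDiff

noncomputable section

/-- A post-Lie algebra: a `k`-module `A` with two `k`-bilinear products, the bracket `br` and the
product `tri`, such that `br` is a Lie bracket, every `tri x` is a derivation of the bracket, and
`[x, y] ▷ z = a(x, y, z) - a(y, x, z)`, where `a(x, y, z) = x ▷ (y ▷ z) - (x ▷ y) ▷ z`. -/
structure IsPostLieAlgebra {k A : Type*} [Field k] [AddCommGroup A] [Module k A]
    (br tri : A →ₗ[k] A →ₗ[k] A) : Prop where
  lie_self : ∀ x, br x x = 0
  jacobi : ∀ x y z, br (br x y) z + br (br y z) x + br (br z x) y = 0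
  tri_br : ∀ x y z, tri x (br y z) = br (tri x y) z + br y (tri x z)
  br_tri : ∀ x y z, tri (br x y) z =
    (tri x (tri y z) - tri (tri x y) z) - (tri y (tri x z) - tri (tri y x) z)

section LieGroup

variable {E : Type*} [NormedAddCommGroup E] [NormedSpace ℝ E]
  {H : Type*} [TopologicalSpace H] (I : ModelWithCorners ℝ E H)
  {G : Type*} [TopologicalSpace G] [ChartedSpace H G]

/-- The tangent space at `p` is, as a topological vector space, the model space `E` (through the
preferred chart at `p`): this is the identity map. It is used to speak of smooth and differentiable
Lie algebra valued functions, and to carry a tangent vector from a base point to an equal one. -/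
def tangentModel (p : G) : TangentSpace I p ≃L[ℝ] E := ContinuousLinearEquiv.refl ℝ E

variable [Group G]

open Classical in
/-- The exponential map of a Lie group: `exp v = γ 1`, where `γ` is the (unique, globally defined)
integral curve through `1` of the left-invariant vector field with value `v` at `1`. -/
def lieExp (v : GroupLieAlgebra I G) : G :=
  if h : ∃ γ : ℝ → G, γ 0 = 1 ∧
      IsMIntegralCurve (I := I) γ (mulInvariantVectorField (I := I) (G := G) v)
  then h.choose 1 else 1

/-- The right-invariant vector field with value `v` at the identity: at `g` it is the image of `v`
under the derivative at `1` of right translation by `g`. -/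
def rightInvariantVectorField (v : GroupLieAlgebra I G) (g : G) : TangentSpace I g :=
  (tangentModel I g).symm (tangentModel I (1 * g) (mfderiv I I (fun h : G => h * g) 1 v))

/-- The bracket on the Lie algebra obtained by identifying it with the right-invariant vector
fields. (Mathlib's bracket `⁅v, w⁆` on `GroupLieAlgebra I G` uses the left-invariant ones.) -/
def rightLieBracket (v w : GroupLieAlgebra I G) : GroupLieAlgebra I G :=
  VectorField.mlieBracket I (rightInvariantVectorField I v) (rightInvariantVectorField I w) (1 : G)

variable {E' : Type*} [NormedAddCommGroup E'] [NormedSpace ℝ E']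
  {H' : Type*} [TopologicalSpace H'] (J : ModelWithCorners ℝ E' H')
  {M : Type*} [TopologicalSpace M] [ChartedSpace H' M]

/-- The infinitesimal generator `λ_*(v, u) = d/dt|_{t=0} exp(t v) • u`, a tangent vector at
`exp(0) • u = u`. -/
def infinitesimalGenerator [MulAction G M] (v : GroupLieAlgebra I G) (u : M) : TangentSpace J u :=
  (tangentModel J u).symm (tangentModel J (lieExp I ((0 : ℝ) • v) • u)
    (mfderiv 𝓘(ℝ, ℝ) J (fun t : ℝ => lieExp I (t • v) • u) 0
      ((NormedSpace.fromTangentSpace (𝕜 := ℝ) (0 : ℝ)).symm 1)))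

/-- The vector field `λ_*(x)` on `M` generated by a Lie algebra valued function `x`. -/
def generatedField [MulAction G M] (x : M → GroupLieAlgebra I G) (u : M) : TangentSpace J u :=
  infinitesimalGenerator I J (x u) u

/-- The Lie derivative of the Lie algebra valued function `y` along the vector field `X`:
`u ↦ dy_u (X u)`. -/
def lieDerivAlong (X : (u : M) → TangentSpace J u) (y : M → GroupLieAlgebra I G) (u : M) :
    GroupLieAlgebra I G :=
  (tangentModel I (1 : G)).symm (mvfderiv J (fun p : M => tangentModel I (1 : G) (y p)) u (X u))

variable (G M) in
/-- `Ω⁰(M, 𝔤)`: the real vector space of smooth functions from `M` to the Lie algebra of `G`. -/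
def smoothLieValued : Submodule ℝ (M → GroupLieAlgebra I G) where
  carrier := {x | ContMDiff J 𝓘(ℝ, E) ∞ (fun p : M => tangentModel I (1 : G) (x p))}
  zero_mem' := by
    simpa using (contMDiff_const : ContMDiff J 𝓘(ℝ, E) ∞ fun _ : M => (0 : E))
  add_mem' := fun {x y} hx hy => by
    have h : ContMDiff J 𝓘(ℝ, E) ∞
        (fun p : M => tangentModel I (1 : G) (x p) + tangentModel I (1 : G) (y p)) :=
      ContMDiff.add hx hy
    simpa using h
  smul_mem' := fun c x hx => by
    have h : ContMDiff J 𝓘(ℝ, E) ∞ (fun p : M => c • tangentModel I (1 : G) (x p)) :=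
      ContMDiff.smul (contMDiff_const : ContMDiff J 𝓘(ℝ, ℝ) ∞ fun _ : M => c) hx
    simpa using h

end LieGroup

end

/-!
`λ_*(v)` at `u` is the derivative at `1` of the orbit map `g ↦ g • u` in the direction `v`, so
`(x ▷ z)(u) = D z u (x u)`, where `D z u` is the derivative at `1` of `g ↦ z (g • u)`. The Leibniz
rule for the pointwise bracket is then that of a derivative. In `x ▷ (y ▷ z) - (x ▷ y) ▷ z` the
terms containing `D y` cancel and the second derivative `D (D z) u (x u) (y u)` remains. Since
`(g * h) • u = g • (h • u)`, the function `h ↦ D z (h • u) w` is the derivative of `h ↦ z (h • u)`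
along the right-invariant field of `w`; hence antisymmetrizing the second derivative produces
`D z u` of the bracket of right-invariant fields. Finally, inversion on `G` pulls the left-invariant
field of `-v` back to the right-invariant field of `v`, which turns one bracket into minus the
other.
-/

open Set Filter Topology VectorField

section LieBracketOfFunctions

variable {𝕜 : Type*} [NontriviallyNormedField 𝕜]
  {E : Type*} [NormedAddCommGroup E] [NormedSpace 𝕜 E]
  {H : Type*} [TopologicalSpace H] {I : ModelWithCorners 𝕜 E H}
  {M : Type*} [TopologicalSpace M] [ChartedSpace H M]
  {F : Type*} [NormedAddCommGroup F] [NormedSpace 𝕜 F]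
  {f : M → F} {V W : (p : M) → TangentSpace I p} {x : M}

theorem fderivWithin_comp_extChartAt_symm_mpullbackWithin [IsManifold I 1 M] {q : E}
    (hq : q ∈ (extChartAt I x).target)
    (hf : MDifferentiableAt I 𝓘(𝕜, F) f ((extChartAt I x).symm q)) :
    fderivWithin 𝕜 (f ∘ (extChartAt I x).symm) (range I) q
        (mpullbackWithin 𝓘(𝕜, E) I (extChartAt I x).symm V (range I) q) =
      mvfderiv I f ((extChartAt I x).symm q) (V ((extChartAt I x).symm q)) := by
  have hcomp := mfderiv_comp_mfderivWithin (s := range I) (f := (extChartAt I x).symm) q hf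
    (mdifferentiableWithinAt_extChartAt_symm hq)
    (I.uniqueMDiffOn _ (extChartAt_target_subset_range x hq))
  rw [mfderivWithin_eq_fderivWithin] at hcomp
  refine (DFunLike.congr_fun hcomp _).trans ?_
  exact congrArg (mvfderiv I f ((extChartAt I x).symm q))
    ((isInvertible_mfderivWithin_extChartAt_symm (I := I) hq).self_apply_inverse _)

theorem eventually_fderivWithin_comp_extChartAt_symm_mpullbackWithin [IsManifold I 1 M]
    (hf : ContMDiffAt I 𝓘(𝕜, F) 1 f x) :
    ∀ᶠ q in 𝓝[range I] extChartAt I x x,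
      fderivWithin 𝕜 (f ∘ (extChartAt I x).symm) (range I) q
          (mpullbackWithin 𝓘(𝕜, E) I (extChartAt I x).symm V (range I) q) =
        mvfderiv I f ((extChartAt I x).symm q) (V ((extChartAt I x).symm q)) := by
  have hcont : Tendsto (extChartAt I x).symm (𝓝[range I] extChartAt I x x) (𝓝 x) := by
    have := continuousAt_extChartAt_symm (I := I) x
    rw [ContinuousAt, extChartAt_to_inv] at this
    exact this.mono_left nhdsWithin_le_nhds
  have hdiff : ∀ᶠ p in 𝓝 x, MDifferentiableAt I 𝓘(𝕜, F) f p :=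
    ((contMDiffAt_iff_contMDiffAt_nhds (by simp)).1 hf).mono
      fun p hp => hp.mdifferentiableAt one_ne_zero
  filter_upwards [extChartAt_target_mem_nhdsWithin x, hcont.eventually hdiff] with q hq hfq
  exact fderivWithin_comp_extChartAt_symm_mpullbackWithin hq hfq

theorem fderivWithin_comp_extChartAt_symm_mpullbackWithin_self [IsManifold I 1 M]
    (hf : MDifferentiableAt I 𝓘(𝕜, F) f x) :
    fderivWithin 𝕜 (f ∘ (extChartAt I x).symm) (range I) (extChartAt I x x)
        (mpullbackWithin 𝓘(𝕜, E) I (extChartAt I x).symm V (range I) (extChartAt I x x)) =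
      mvfderiv I f x (V x) := by
  have hx : (extChartAt I x).symm (extChartAt I x x) = x := extChartAt_to_inv x
  rw [fderivWithin_comp_extChartAt_symm_mpullbackWithin (mem_extChartAt_target x) (by rwa [hx]),
    hx]

theorem differentiableWithinAt_mpullbackWithin_extChartAt_symm [CompleteSpace E] [IsManifold I 2 M]
    (hV : MDifferentiableAt I I.tangent (fun p => (⟨p, V p⟩ : TangentBundle I M)) x) :
    DifferentiableWithinAt 𝕜 (mpullbackWithin 𝓘(𝕜, E) I (extChartAt I x).symm V (range I))
      (range I) (extChartAt I x x) := by
  simpa only [preimage_univ, univ_inter] using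
    hV.mdifferentiableWithinAt.differentiableWithinAt_mpullbackWithin_vectorField (s := univ)

theorem mpullbackWithin_extChartAt_symm_mlieBracket [CompleteSpace E]
    [IsManifold I (minSmoothness 𝕜 2) M]
    (hV : MDifferentiableAt I I.tangent (fun p => (⟨p, V p⟩ : TangentBundle I M)) x)
    (hW : MDifferentiableAt I I.tangent (fun p => (⟨p, W p⟩ : TangentBundle I M)) x) :
    mpullbackWithin 𝓘(𝕜, E) I (extChartAt I x).symm (mlieBracket I V W) (range I)
        (extChartAt I x x) =
      lieBracketWithin 𝕜 (mpullbackWithin 𝓘(𝕜, E) I (extChartAt I x).symm V (range I))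
        (mpullbackWithin 𝓘(𝕜, E) I (extChartAt I x).symm W (range I)) (range I)
        (extChartAt I x x) := by
  have hx : (extChartAt I x).symm (extChartAt I x x) = x := extChartAt_to_inv x
  rw [← mlieBracketWithin_univ, ← mlieBracketWithin_eq_lieBracketWithin]
  exact mpullbackWithin_mlieBracketWithin (by rw [hx]; exact hV.mdifferentiableWithinAt)
    (by rw [hx]; exact hW.mdifferentiableWithinAt) I.uniqueMDiffOn
    (contMDiffWithinAt_extChartAt_symm_range x (mem_extChartAt_target x)) (mem_range_self _)
    le_rfl univ_mem (I.range_subset_closure_interior (mem_range_self _))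

theorem mdifferentiableAt_mvfderiv_apply [CompleteSpace E] [IsManifold I 2 M]
    (hf : ContMDiffAt I 𝓘(𝕜, F) 2 f x)
    (hV : MDifferentiableAt I I.tangent (fun p => (⟨p, V p⟩ : TangentBundle I M)) x) :
    MDifferentiableAt I 𝓘(𝕜, F) (fun p => mvfderiv I f p (V p)) x := by
  have hfderiv : DifferentiableWithinAt 𝕜
      (fderivWithin 𝕜 (f ∘ (extChartAt I x).symm) (range I)) (range I) (extChartAt I x x) :=
    ((contMDiffAt_iff.1 hf).2.fderivWithin_right (m := 1) I.uniqueDiffOn le_rfl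
      (mem_range_self _)).differentiableWithinAt one_ne_zero
  refine mdifferentiableWithinAt_univ.1
    (DifferentiableWithinAt.mdifferentiableWithinAt_of_comp_extChartAt_symm ?_)
  rw [preimage_univ, univ_inter]
  exact (hfderiv.clm_apply
    (differentiableWithinAt_mpullbackWithin_extChartAt_symm hV)).congr_of_eventuallyEq_of_mem
    ((eventually_fderivWithin_comp_extChartAt_symm_mpullbackWithin
      (hf.of_le one_le_two)).mono fun q hq => hq.symm) (mem_range_self _)

theorem mvfderiv_apply_mlieBracket [CompleteSpace E] {n : ℕ∞ω} (hn : minSmoothness 𝕜 2 ≤ n)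
    [IsManifold I (minSmoothness 𝕜 2) M] (hf : ContMDiffAt I 𝓘(𝕜, F) n f x)
    (hV : MDifferentiableAt I I.tangent (fun p => (⟨p, V p⟩ : TangentBundle I M)) x)
    (hW : MDifferentiableAt I I.tangent (fun p => (⟨p, W p⟩ : TangentBundle I M)) x) :
    mvfderiv I f x (mlieBracket I V W x) =
      mvfderiv I (fun p => mvfderiv I f p (W p)) x (V x) -
        mvfderiv I (fun p => mvfderiv I f p (V p)) x (W x) := by
  have hf2 : ContMDiffAt I 𝓘(𝕜, F) 2 f x := hf.of_le (le_minSmoothness.trans hn)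
  have hderiv_eq (X : (p : M) → TangentSpace I p) :
      fderivWithin 𝕜 (fun q => fderivWithin 𝕜 (f ∘ (extChartAt I x).symm) (range I) q
          (mpullbackWithin 𝓘(𝕜, E) I (extChartAt I x).symm X (range I) q)) (range I)
          (extChartAt I x x) =
        fderivWithin 𝕜 ((fun p => mvfderiv I f p (X p)) ∘ (extChartAt I x).symm) (range I)
          (extChartAt I x x) :=
    Filter.EventuallyEq.fderivWithin_eq_of_mem
      (eventually_fderivWithin_comp_extChartAt_symm_mpullbackWithin (hf2.of_le one_le_two))
      (mem_range_self _)
  rw [← fderivWithin_comp_extChartAt_symm_mpullbackWithin_self (hf2.mdifferentiableAt two_ne_zero),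
    ← fderivWithin_comp_extChartAt_symm_mpullbackWithin_self
      (mdifferentiableAt_mvfderiv_apply hf2 hV),
    ← fderivWithin_comp_extChartAt_symm_mpullbackWithin_self
      (mdifferentiableAt_mvfderiv_apply hf2 hW),
    mpullbackWithin_extChartAt_symm_mlieBracket hV hW]
  refine (fderivWithin_apply_lieBracket (contMDiffAt_iff.1 hf).2 hn I.uniqueDiffOn
    (I.range_subset_closure_interior (mem_range_self _)) (mem_range_self _)
    (differentiableWithinAt_mpullbackWithin_extChartAt_symm hW)
    (differentiableWithinAt_mpullbackWithin_extChartAt_symm hV)).trans ?_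
  exact congrArg₂ (· - ·) (DFunLike.congr_fun (hderiv_eq W) _)
    (DFunLike.congr_fun (hderiv_eq V) _)

end LieBracketOfFunctions

section InvariantVectorFields

variable {𝕜 : Type*} [NontriviallyNormedField 𝕜]
  {E : Type*} [NormedAddCommGroup E] [NormedSpace 𝕜 E]
  {H : Type*} [TopologicalSpace H] {I : ModelWithCorners 𝕜 E H}
  {G : Type*} [TopologicalSpace G] [ChartedSpace H G] [Group G]

instance lieGroup_one_of_minSmoothness_three [LieGroup I (minSmoothness 𝕜 3) G] :
    LieGroup I 1 G :=
  LieGroup.of_le (n := minSmoothness 𝕜 3) (le_trans (by norm_cast) le_minSmoothness)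

theorem mfderiv_one_mul (g : G) :
    @Eq (E →L[𝕜] E) (mfderiv I I (fun x : G => 1 * x) g) (ContinuousLinearMap.id 𝕜 E) := by
  have h : (fun x : G => 1 * x) = id := funext one_mul
  rw [h]
  exact mfderiv_id

theorem mfderiv_mul_one (g : G) :
    @Eq (E →L[𝕜] E) (mfderiv I I (fun x : G => x * 1) g) (ContinuousLinearMap.id 𝕜 E) := by
  have h : (fun x : G => x * 1) = id := funext mul_one
  rw [h]
  exact mfderiv_id

theorem mulInvariantVectorField_one (v : GroupLieAlgebra I G) :
    mulInvariantVectorField v (1 : G) = v :=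
  DFunLike.congr_fun (mfderiv_one_mul (I := I) (1 : G)) v

variable [LieGroup I 1 G]

variable (I G) in
theorem mdifferentiable_inv : MDifferentiable I I (fun g : G => g⁻¹) :=
  (contMDiff_inv I 1).mdifferentiable one_ne_zero

theorem mfderiv_mul_left_mulInvariantVectorField (v : GroupLieAlgebra I G) (g h : G) :
    mfderiv I I (g * ·) h (mulInvariantVectorField v h) = mulInvariantVectorField v (g * h) := by
  have hcomp : (g * h * ·) = (g * ·) ∘ (h * ·) := by
    ext x; exact mul_assoc g h x
  simp only [mulInvariantVectorField]
  rw [hcomp, mfderiv_comp_of_eq mdifferentiableAt_mul_left mdifferentiableAt_mul_left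
    (mul_one h)]
  exact DFunLike.congr_fun (F := E →L[𝕜] E) (mfderiv_congr_point (mul_one h).symm) _

theorem mfderiv_mul_one_one_apply (v w : E) :
    @Eq E (mfderiv (I.prod I) I (fun p : G × G => p.1 * p.2) (1, 1) (v, w)) (v + w) := by
  refine (mfderiv_prod_eq_add_apply (v := ((v, w) : E × E))
    ((contMDiff_mul I 1).mdifferentiable one_ne_zero (1, 1))).trans ?_
  exact congrArg₂ (fun A B : E →L[𝕜] E => A v + B w) (mfderiv_mul_one 1) (mfderiv_one_mul 1)

theorem mfderiv_inv_one_apply (v : E) :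
    @Eq E (mfderiv I I (fun g : G => g⁻¹) 1 v) (-v) := by
  have hconst := mfderiv_comp_apply_of_eq (g := fun p : G × G => p.1 * p.2)
    (f := fun g : G => (g, g⁻¹)) (x := 1) (y := (1, 1))
    ((contMDiff_mul I 1).mdifferentiable one_ne_zero _)
    (mdifferentiableAt_id.prodMk (mdifferentiable_inv I G 1)) (by simp) v
  have hpair : @Eq (E × E) (mfderiv I (I.prod I) (fun g : G => (g, g⁻¹)) 1 v)
      (v, mfderiv I I (fun g : G => g⁻¹) 1 v) :=
    DFunLike.congr_fun
      (hasMFDerivAt_id (1 : G) |>.prodMk (mdifferentiable_inv I G 1).hasMFDerivAt).mfderiv v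
  have hmul : (fun p : G × G => p.1 * p.2) ∘ (fun g : G => (g, g⁻¹)) = fun _ => (1 : G) := by
    ext g; exact mul_inv_cancel g
  rw [hmul, mfderiv_const] at hconst
  refine eq_neg_of_add_eq_zero_right (α := E) ?_
  exact ((congrArg _ hpair).trans (mfderiv_mul_one_one_apply v _)).symm.trans hconst.symm

theorem mfderiv_inv_comp_mfderiv_inv (g : G) :
    @Eq (E →L[𝕜] E) ((mfderiv I I (fun x : G => x⁻¹) g⁻¹).comp (mfderiv I I (fun x : G => x⁻¹) g))
      (ContinuousLinearMap.id 𝕜 E) := by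
  have h := mfderiv_comp g (mdifferentiable_inv I G g⁻¹) (mdifferentiable_inv I G g)
  have hinv : (fun x : G => x⁻¹) ∘ (fun x : G => x⁻¹) = id := by
    ext x; exact inv_inv x
  rw [hinv, mfderiv_id] at h
  exact h.symm

theorem mfderiv_inv_comp_mfderiv_inv' (g : G) :
    @Eq (E →L[𝕜] E) (ContinuousLinearMap.comp (M₂ := E)
      (mfderiv I I (fun x : G => x⁻¹) g : E →L[𝕜] E)
      (mfderiv I I (fun x : G => x⁻¹) g⁻¹ : E →L[𝕜] E)) (ContinuousLinearMap.id 𝕜 E) := by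
  have h := mfderiv_inv_comp_mfderiv_inv (I := I) g⁻¹
  have hinv : @Eq (E →L[𝕜] E) (mfderiv I I (fun x : G => x⁻¹) g⁻¹⁻¹)
    (mfderiv I I (fun x : G => x⁻¹) g) := mfderiv_congr_point (inv_inv g)
  exact (congrArg (fun A : E →L[𝕜] E =>
    A.comp (mfderiv I I (fun x : G => x⁻¹) g⁻¹ : E →L[𝕜] E)) hinv).symm.trans h

theorem inverse_mfderiv_inv (g : G) :
    (mfderiv I I (fun x : G => x⁻¹) g).inverse = mfderiv I I (fun x : G => x⁻¹) g⁻¹ :=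
  ContinuousLinearMap.inverse_eq (mfderiv_inv_comp_mfderiv_inv' (I := I) (E := E) g)
    (mfderiv_inv_comp_mfderiv_inv (I := I) (E := E) g)

theorem isInvertible_mfderiv_inv (g : G) : (mfderiv I I (fun x : G => x⁻¹) g).IsInvertible :=
  .of_inverse (mfderiv_inv_comp_mfderiv_inv' (I := I) (E := E) g)
    (mfderiv_inv_comp_mfderiv_inv (I := I) (E := E) g)

end InvariantVectorFields

section RightInvariantVectorFields

variable {E : Type*} [NormedAddCommGroup E] [NormedSpace ℝ E]
  {H : Type*} [TopologicalSpace H] {I : ModelWithCorners ℝ E H}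
  {G : Type*} [TopologicalSpace G] [ChartedSpace H G] [Group G]

theorem rightInvariantVectorField_one (v : GroupLieAlgebra I G) :
    rightInvariantVectorField I v (1 : G) = v :=
  DFunLike.congr_fun (mfderiv_mul_one (I := I) (1 : G)) v

theorem mfderiv_inv_mulInvariantVectorField [LieGroup I 1 G] (v : GroupLieAlgebra I G) (g : G) :
    @Eq E (mfderiv I I (fun x : G => x⁻¹) g⁻¹ (mulInvariantVectorField (-v) g⁻¹))
      (rightInvariantVectorField I v g) := by
  have hcomp : (fun x : G => x⁻¹) ∘ (g⁻¹ * ·) = (· * g) ∘ (fun x : G => x⁻¹) := by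
    ext x; simp only [Function.comp_apply, mul_inv_rev, inv_inv]
  have hleft := mfderiv_comp_apply_of_eq (g := fun x : G => x⁻¹) (1 : G)
    (mdifferentiable_inv I G g⁻¹) mdifferentiableAt_mul_left (mul_one g⁻¹) (-v)
  have hright := mfderiv_comp_apply_of_eq (g := (· * g)) (1 : G)
    (mdifferentiableAt_mul_right (I := I)) (mdifferentiable_inv I G 1) inv_one (-v)
  have hneg : @Eq E (mfderiv I I (fun x : G => x⁻¹) 1 (-v)) v :=
    (mfderiv_inv_one_apply (I := I) (-v)).trans (neg_neg (G := E) v)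
  rw [hcomp] at hleft
  refine hleft.symm.trans (hright.trans ?_)
  exact congrArg (mfderiv I I (· * g) (1 : G)) hneg

theorem rightInvariantVectorField_eq_mpullback_inv [LieGroup I 1 G] (v : GroupLieAlgebra I G) :
    rightInvariantVectorField I v =
      mpullback I I (fun g : G => g⁻¹) (mulInvariantVectorField (-v)) := by
  ext g
  refine (mfderiv_inv_mulInvariantVectorField v g).symm.trans ?_
  exact (DFunLike.congr_fun (inverse_mfderiv_inv (I := I) g)
    (mulInvariantVectorField (-v) g⁻¹)).symm

variable [LieGroup I (minSmoothness ℝ 3) G] [CompleteSpace E]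

theorem mdifferentiable_rightInvariantVectorField (v : GroupLieAlgebra I G) :
    MDifferentiable I I.tangent
      (fun g : G => (⟨g, rightInvariantVectorField I v g⟩ : TangentBundle I G)) := by
  rw [rightInvariantVectorField_eq_mpullback_inv]
  exact (mdifferentiable_mulInvariantVectorField (-v)).mpullback_vectorField
    (contMDiff_inv I (minSmoothness ℝ 3)) isInvertible_mfderiv_inv
    (le_trans (by norm_cast) le_minSmoothness)

theorem rightLieBracket_eq_neg_lie (v w : GroupLieAlgebra I G) :
    rightLieBracket I v w = -⁅v, w⁆ := by
  rw [rightLieBracket, rightInvariantVectorField_eq_mpullback_inv,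
    rightInvariantVectorField_eq_mpullback_inv, ← mpullback_mlieBracket
      (mdifferentiableAt_mulInvariantVectorField _) (mdifferentiableAt_mulInvariantVectorField _)
      (contMDiff_inv I (minSmoothness ℝ 3)).contMDiffAt (minSmoothness_monotone (by norm_cast)),
    ← mulInvariantVector_mlieBracket, ← GroupLieAlgebra.bracket_def,
    ← neg_neg ⁅(-v : GroupLieAlgebra I G), (-w : GroupLieAlgebra I G)⁆,
    ← rightInvariantVectorField_eq_mpullback_inv, rightInvariantVectorField_one, neg_lie, lie_neg,
    neg_neg]

end RightInvariantVectorFields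

section Exponential

variable {E : Type*} [NormedAddCommGroup E] [NormedSpace ℝ E]
  {H : Type*} [TopologicalSpace H] {I : ModelWithCorners ℝ E H}
  {G : Type*} [TopologicalSpace G] [ChartedSpace H G] [Group G]
  [LieGroup I (minSmoothness ℝ 3) G]

theorem contMDiff_one_mulInvariantVectorField (v : GroupLieAlgebra I G) :
    ContMDiff I I.tangent 1
      (fun g : G => (⟨g, mulInvariantVectorField v g⟩ : TangentBundle I G)) :=
  (contMDiff_mulInvariantVectorField v).of_le (one_le_two.trans le_minSmoothness)

theorem isMIntegralCurveOn_const_mul_mulInvariantVectorField {v : GroupLieAlgebra I G}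
    {γ : ℝ → G} {s : Set ℝ} (hγ : IsMIntegralCurveOn γ (mulInvariantVectorField v) s) (g : G) :
    IsMIntegralCurveOn (g * γ ·) (mulInvariantVectorField v) s := by
  intro t ht
  refine ((mdifferentiableAt_mul_left (I := I)).hasMFDerivAt.comp_hasMFDerivWithinAt t
    (hγ t ht)).congr_mfderiv ?_
  ext
  change mfderiv I I (g * ·) (γ t) ((1 : ℝ) • mulInvariantVectorField v (γ t)) =
    (1 : ℝ) • mulInvariantVectorField v (g * γ t)
  rw [one_smul, one_smul]
  exact mfderiv_mul_left_mulInvariantVectorField v g (γ t)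

variable [CompleteSpace E] [T2Space G] [BoundarylessManifold I G]

theorem exists_isMIntegralCurve_mulInvariantVectorField (v : GroupLieAlgebra I G) :
    ∃ γ : ℝ → G, γ 0 = 1 ∧ IsMIntegralCurve γ (mulInvariantVectorField v) := by
  obtain ⟨γ, hγ_zero, hγ⟩ := exists_isMIntegralCurveAt_of_contMDiffAt_boundaryless (t₀ := 0)
    (contMDiff_one_mulInvariantVectorField (I := I) (G := G) v).contMDiffAt (x₀ := 1)
  obtain ⟨ε, hε, hγ_ball⟩ := isMIntegralCurveAt_iff'.1 hγ
  rw [Real.ball_eq_Ioo, zero_sub, zero_add] at hγ_ball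
  exact exists_isMIntegralCurve_of_isMIntegralCurveOn (contMDiff_one_mulInvariantVectorField v) hε
    (fun g => ⟨(g * γ ·), by simp only [hγ_zero, mul_one],
      isMIntegralCurveOn_const_mul_mulInvariantVectorField hγ_ball g⟩) 1

theorem lieExp_smul {v : GroupLieAlgebra I G} {γ : ℝ → G} (hγ_zero : γ 0 = 1)
    (hγ : IsMIntegralCurve γ (mulInvariantVectorField v)) (t : ℝ) : lieExp I (t • v) = γ t := by
  have hexists := exists_isMIntegralCurve_mulInvariantVectorField (t • v)
  have hγ_mul : IsMIntegralCurve (γ ∘ (· * t)) (mulInvariantVectorField (t • v)) := by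
    rw [mulInvariantVectorField_smul]
    exact hγ.comp_mul t
  have huniq := isMIntegralCurve_Ioo_eq_of_contMDiff_boundaryless (t₀ := 0)
    (contMDiff_one_mulInvariantVectorField (t • v)) hexists.choose_spec.2 hγ_mul
    (by simp [hexists.choose_spec.1, hγ_zero])
  rw [lieExp, dif_pos hexists, huniq, Function.comp_apply, one_mul]

theorem hasMFDerivAt_lieExp_smul (v : GroupLieAlgebra I G) :
    HasMFDerivAt 𝓘(ℝ, ℝ) I (fun t : ℝ => lieExp I (t • v)) 0
      ((1 : ℝ →L[ℝ] ℝ).smulRight (mulInvariantVectorField v (lieExp I ((0 : ℝ) • v)))) := by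
  obtain ⟨γ, hγ_zero, hγ⟩ := exists_isMIntegralCurve_mulInvariantVectorField v
  have hexp : (fun t : ℝ => lieExp I (t • v)) = γ := funext (lieExp_smul hγ_zero hγ)
  rw [congrFun hexp 0, hexp]
  exact hγ 0

theorem lieExp_zero : lieExp I (0 : GroupLieAlgebra I G) = 1 := by
  obtain ⟨γ, hγ_zero, hγ⟩ :=
    exists_isMIntegralCurve_mulInvariantVectorField (0 : GroupLieAlgebra I G)
  rw [← zero_smul ℝ (0 : GroupLieAlgebra I G), lieExp_smul hγ_zero hγ, hγ_zero]

theorem mfderiv_lieExp_smul_zero_apply_one (v : GroupLieAlgebra I G) :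
    @Eq E (mfderiv 𝓘(ℝ, ℝ) I (fun t : ℝ => lieExp I (t • v)) 0 (1 : ℝ)) v := by
  have hfield : ∀ g : G, g = 1 → @Eq E (mulInvariantVectorField v g) v := by
    rintro _ rfl
    exact mulInvariantVectorField_one v
  exact (DFunLike.congr_fun (hasMFDerivAt_lieExp_smul v).mfderiv (1 : ℝ)).trans
    ((one_smul ℝ _).trans (hfield _ (by rw [zero_smul, lieExp_zero])))

end Exponential

section Leibniz

variable {𝕜 : Type*} [NontriviallyNormedField 𝕜]
  {E : Type*} [NormedAddCommGroup E] [NormedSpace 𝕜 E]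
  {H : Type*} [TopologicalSpace H] {I : ModelWithCorners 𝕜 E H}
  {M : Type*} [TopologicalSpace M] [ChartedSpace H M]
  {F₁ F₂ F₃ : Type*} [NormedAddCommGroup F₁] [NormedSpace 𝕜 F₁]
  [NormedAddCommGroup F₂] [NormedSpace 𝕜 F₂] [NormedAddCommGroup F₃] [NormedSpace 𝕜 F₃] {x : M}

theorem mvfderiv_clm_comp (A : F₁ →L[𝕜] F₂) {a : M → F₁} (ha : MDifferentiableAt I 𝓘(𝕜, F₁) a x)
    (u : TangentSpace I x) : mvfderiv I (fun p => A (a p)) x u = A (mvfderiv I a x u) :=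
  DFunLike.congr_fun ((A.hasFDerivAt (x := a x)).hasMFDerivAt.comp x ha.hasMFDerivAt).mfderiv u

theorem mvfderiv_bilinear (B : F₁ →L[𝕜] F₂ →L[𝕜] F₃) {a : M → F₁} {b : M → F₂}
    (ha : MDifferentiableAt I 𝓘(𝕜, F₁) a x) (hb : MDifferentiableAt I 𝓘(𝕜, F₂) b x)
    (u : TangentSpace I x) :
    mvfderiv I (fun p => B (a p) (b p)) x u =
      B (a x) (mvfderiv I b x u) + B (mvfderiv I a x u) (b x) := by
  have hab : HasMFDerivAt I 𝓘(𝕜, F₁ × F₂) (fun p => (a p, b p)) x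
      ((mvfderiv I a x).prod (mvfderiv I b x)) :=
    ⟨ha.hasMFDerivAt.1.prodMk hb.hasMFDerivAt.1, ha.hasMFDerivAt.2.prodMk hb.hasMFDerivAt.2⟩
  have hB := HasMFDerivAt.comp (g := fun q : F₁ × F₂ => B q.1 q.2) x
    (B.isBoundedBilinearMap.hasFDerivAt (a x, b x)).hasMFDerivAt hab
  exact DFunLike.congr_fun hB.mfderiv u

end Leibniz

section ActionDeriv

variable {𝕜 : Type*} [NontriviallyNormedField 𝕜]
  {E : Type*} [NormedAddCommGroup E] [NormedSpace 𝕜 E]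
  {H : Type*} [TopologicalSpace H] (I : ModelWithCorners 𝕜 E H)
  (G : Type*) [TopologicalSpace G] [ChartedSpace H G] [Group G]
  {M : Type*} [MulAction G M]
  {F : Type*} [NormedAddCommGroup F] [NormedSpace 𝕜 F]
  {F₁ F₂ F₃ : Type*} [NormedAddCommGroup F₁] [NormedSpace 𝕜 F₁]
  [NormedAddCommGroup F₂] [NormedSpace 𝕜 F₂] [NormedAddCommGroup F₃] [NormedSpace 𝕜 F₃]

/-- The derivative at the identity of `g ↦ z (g • u)`, that is, the derivative at `u` of the vector
valued function `z` along the orbit of `u`, as a linear map on the Lie algebra of `G`. The Lie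
algebra is written as the model space `E`, so that `actionDeriv` can be iterated. -/
noncomputable def actionDeriv (z : M → F) (u : M) : E →L[𝕜] F :=
  mvfderiv I (fun g : G => z (g • u)) 1

variable {I G} {u : M}

theorem actionDeriv_add {y z : M → F}
    (hy : MDifferentiableAt I 𝓘(𝕜, F) (fun g : G => y (g • u)) 1)
    (hz : MDifferentiableAt I 𝓘(𝕜, F) (fun g : G => z (g • u)) 1) :
    actionDeriv I G (y + z) u = actionDeriv I G y u + actionDeriv I G z u :=
  mvfderiv_add hy hz

theorem actionDeriv_clm_comp (A : F₁ →L[𝕜] F₂) {z : M → F₁}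
    (hz : MDifferentiableAt I 𝓘(𝕜, F₁) (fun g : G => z (g • u)) 1) (v : E) :
    actionDeriv I G (fun p => A (z p)) u v = A (actionDeriv I G z u v) :=
  mvfderiv_clm_comp A hz v

theorem actionDeriv_bilinear (B : F₁ →L[𝕜] F₂ →L[𝕜] F₃) {a : M → F₁} {b : M → F₂}
    (ha : MDifferentiableAt I 𝓘(𝕜, F₁) (fun g : G => a (g • u)) 1)
    (hb : MDifferentiableAt I 𝓘(𝕜, F₂) (fun g : G => b (g • u)) 1) (v : E) :
    actionDeriv I G (fun p => B (a p) (b p)) u v =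
      B (a u) (actionDeriv I G b u v) + B (actionDeriv I G a u v) (b u) := by
  have h := mvfderiv_bilinear B ha hb v
  rw [one_smul] at h
  exact h

theorem actionDeriv_actionDeriv_apply {z : M → F} {y : M → E}
    (hz : MDifferentiableAt I 𝓘(𝕜, E →L[𝕜] F) (fun g : G => actionDeriv I G z (g • u)) 1)
    (hy : MDifferentiableAt I 𝓘(𝕜, E) (fun g : G => y (g • u)) 1) (v : E) :
    actionDeriv I G (fun p => actionDeriv I G z p (y p)) u v =
      actionDeriv I G z u (actionDeriv I G y u v) +
        actionDeriv I G (actionDeriv I G z) u v (y u) :=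
  actionDeriv_bilinear (ContinuousLinearMap.id 𝕜 (E →L[𝕜] F)) hz hy v

variable {E' : Type*} [NormedAddCommGroup E'] [NormedSpace 𝕜 E']
  {H' : Type*} [TopologicalSpace H'] {J : ModelWithCorners 𝕜 E' H'}
  [TopologicalSpace M] [ChartedSpace H' M] {m n : ℕ∞ω}

theorem contMDiffAt_comp_smul (hact : ContMDiff (I.prod J) J n (fun p : G × M => p.1 • p.2))
    {z : M → F} (hz : ContMDiffAt J 𝓘(𝕜, F) n z u) :
    ContMDiffAt I 𝓘(𝕜, F) n (fun g : G => z (g • u)) 1 :=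
  ContMDiffAt.comp_of_eq (g := z) hz
    (hact.comp (contMDiff_id.prodMk contMDiff_const)).contMDiffAt (one_smul G u)

theorem contMDiffAt_actionDeriv [IsManifold I 1 G] [IsManifold J 1 M]
    (hact : ContMDiff (I.prod J) J n (fun p : G × M => p.1 • p.2)) (hmn : m + 1 ≤ n)
    {z : M → F} (hz : ContMDiffAt J 𝓘(𝕜, F) n z u) :
    ContMDiffAt J 𝓘(𝕜, E →L[𝕜] F) m (actionDeriv I G z) u := by
  have huncurry : ContMDiffAt (J.prod I) 𝓘(𝕜, F) n
      (Function.uncurry fun (p : M) (g : G) => z (g • p)) (u, 1) :=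
    ContMDiffAt.comp_of_eq (g := z) hz
      (hact.comp (contMDiff_snd.prodMk contMDiff_fst)).contMDiffAt (one_smul G u)
  refine (ContMDiffAt.mfderiv (fun (p : M) (g : G) => z (g • p)) (fun _ => (1 : G)) huncurry
    contMDiffAt_const hmn).congr_of_eventuallyEq (Eventually.of_forall fun p => ?_)
  refine Eq.trans ?_ (inTangentCoordinates_eq_mfderiv_comp (I := I) (I' := 𝓘(𝕜, F))
    (f := fun _ : M => (1 : G)) (mem_chart_source H (1 : G))
    (by rw [chartAt_self_eq]; exact mem_univ _)).symm
  have hid (q r : F) : @Eq (F →L[𝕜] F) (mfderiv 𝓘(𝕜, F) 𝓘(𝕜, F) (extChartAt 𝓘(𝕜, F) q) r)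
      (ContinuousLinearMap.id 𝕜 F) := by
    rw [extChartAt_model_space_eq_id]
    exact mfderiv_id
  ext v
  exact ((DFunLike.congr_fun (hid _ _) _).trans (congrArg (mfderiv I 𝓘(𝕜, F) _ (1 : G))
    (DFunLike.congr_fun (mfderivWithin_range_extChartAt_symm (I := I) (x := (1 : G))) v))).symm

end ActionDeriv

section ActionDerivRightInvariant

variable {E : Type*} [NormedAddCommGroup E] [NormedSpace ℝ E]
  {H : Type*} [TopologicalSpace H] {I : ModelWithCorners ℝ E H}
  {G : Type*} [TopologicalSpace G] [ChartedSpace H G] [Group G]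
  {M : Type*} [MulAction G M]
  {F : Type*} [NormedAddCommGroup F] [NormedSpace ℝ F] {z : M → F} {u : M}

theorem actionDeriv_smul_apply [LieGroup I 1 G] {h : G}
    (hz : MDifferentiableAt I 𝓘(ℝ, F) (fun g : G => z (g • u)) h) (w : GroupLieAlgebra I G) :
    actionDeriv I G z (h • u) w =
      mvfderiv I (fun g : G => z (g • u)) h (rightInvariantVectorField I w h) := by
  have hcomp : (fun g : G => z (g • h • u)) = (fun g : G => z (g • u)) ∘ (· * h) := by
    ext g; simp only [Function.comp_apply, mul_smul]
  have hchain := mfderiv_comp_apply_of_eq (g := fun g : G => z (g • u)) (1 : G) hz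
    (mdifferentiableAt_mul_right (I := I)) (one_mul h) w
  rw [← hcomp] at hchain
  exact hchain

theorem actionDeriv_actionDeriv_eq_mvfderiv_mvfderiv [LieGroup I 1 G]
    (hz : ContMDiffAt I 𝓘(ℝ, F) 1 (fun g : G => z (g • u)) 1)
    (hDz : MDifferentiableAt I 𝓘(ℝ, E →L[ℝ] F) (fun g : G => actionDeriv I G z (g • u)) 1)
    (v w : E) :
    actionDeriv I G (actionDeriv I G z) u v w =
      mvfderiv I (fun h : G => mvfderiv I (fun g : G => z (g • u)) h
        (rightInvariantVectorField I w h)) 1 v := by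
  have heq : (fun h : G => actionDeriv I G z (h • u) w) =ᶠ[𝓝 1] fun h : G =>
      mvfderiv I (fun g : G => z (g • u)) h (rightInvariantVectorField I w h) :=
    ((contMDiffAt_iff_contMDiffAt_nhds (by simp)).1 hz).mono
      fun h hh => actionDeriv_smul_apply (hh.mdifferentiableAt one_ne_zero) w
  exact (actionDeriv_clm_comp (ContinuousLinearMap.apply ℝ F w) hDz v).symm.trans
    (DFunLike.congr_fun (F := E →L[ℝ] F) heq.mfderiv_eq v)

theorem actionDeriv_apply_rightLieBracket [LieGroup I (minSmoothness ℝ 3) G] [CompleteSpace E]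
    (hz : ContMDiffAt I 𝓘(ℝ, F) 2 (fun g : G => z (g • u)) 1)
    (hDz : MDifferentiableAt I 𝓘(ℝ, E →L[ℝ] F) (fun g : G => actionDeriv I G z (g • u)) 1)
    (v w : GroupLieAlgebra I G) :
    actionDeriv I G z u (rightLieBracket I v w) =
      actionDeriv I G (actionDeriv I G z) u v w - actionDeriv I G (actionDeriv I G z) u w v := by
  have hbracket := mvfderiv_apply_mlieBracket minSmoothness_of_isRCLikeNormedField.le hz
    (mdifferentiable_rightInvariantVectorField v 1) (mdifferentiable_rightInvariantVectorField w 1)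
  rw [rightInvariantVectorField_one, rightInvariantVectorField_one] at hbracket
  have hsecond := actionDeriv_actionDeriv_eq_mvfderiv_mvfderiv (hz.of_le one_le_two) hDz
  exact hbracket.trans (congrArg₂ (α := F) (· - ·) (hsecond v w).symm (hsecond w v).symm)

end ActionDerivRightInvariant

section RightLieBracketCLM

variable {E : Type*} [NormedAddCommGroup E] [NormedSpace ℝ E]
  {H : Type*} [TopologicalSpace H] (I : ModelWithCorners ℝ E H)
  (G : Type*) [TopologicalSpace G] [ChartedSpace H G] [Group G]

/-- The bracket `rightLieBracket` as a continuous bilinear map on the model space `E`, namely the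
antisymmetrization of the second derivative at `1` of the chart of `G` along the action of `G` on
itself by left translations. This is what makes pointwise brackets of smooth functions smooth. -/
noncomputable def rightLieBracketCLM : E →L[ℝ] E →L[ℝ] E :=
  actionDeriv I G (actionDeriv I G (extChartAt I (1 : G))) 1 -
    (actionDeriv I G (actionDeriv I G (extChartAt I (1 : G))) 1).flip

variable [CompleteSpace E] [LieGroup I (minSmoothness ℝ 3) G]

theorem rightLieBracketCLM_apply (v w : GroupLieAlgebra I G) :
    rightLieBracketCLM I G v w = rightLieBracket I v w := by
  have hmul : ContMDiff (I.prod I) I (minSmoothness ℝ 3) (fun p : G × G => p.1 • p.2) :=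
    contMDiff_mul I _
  have hchart : ContMDiffAt I 𝓘(ℝ, E) (minSmoothness ℝ 3) (extChartAt I (1 : G)) 1 :=
    contMDiffAt_extChartAt
  have htwo : (2 : ℕ∞ω) ≤ minSmoothness ℝ 3 := le_trans (by norm_cast) le_minSmoothness
  have hDchart : ContMDiffAt I 𝓘(ℝ, E →L[ℝ] E) 1 (actionDeriv I G (extChartAt I (1 : G))) 1 :=
    contMDiffAt_actionDeriv (hmul.of_le htwo) le_rfl (hchart.of_le htwo)
  have hid : actionDeriv I G (extChartAt I (1 : G)) 1 = ContinuousLinearMap.id ℝ E := by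
    simp only [actionDeriv, smul_eq_mul, mul_one]
    exact mfderiv_extChartAt_self
  have hbracket := actionDeriv_apply_rightLieBracket
    ((contMDiffAt_comp_smul hmul hchart).of_le htwo)
    ((contMDiffAt_comp_smul (hmul.of_le (one_le_two.trans htwo)) hDchart).mdifferentiableAt
      one_ne_zero) v w
  rw [hid] at hbracket
  exact hbracket.symm

theorem rightLieBracket_jacobi (x y z : GroupLieAlgebra I G) :
    rightLieBracket I (rightLieBracket I x y) z + rightLieBracket I (rightLieBracket I y z) x +
      rightLieBracket I (rightLieBracket I z x) y = 0 := by
  simp only [rightLieBracket_eq_neg_lie, neg_lie, neg_neg]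
  rw [← lie_skew ⁅x, y⁆ z, ← lie_skew ⁅y, z⁆ x, ← lie_skew ⁅z, x⁆ y, ← neg_add, ← neg_add,
    neg_eq_zero, ← lie_jacobi x y z]
  abel

end RightLieBracketCLM

section InfinitesimalGenerator

variable {E : Type*} [NormedAddCommGroup E] [NormedSpace ℝ E] [CompleteSpace E]
  {H : Type*} [TopologicalSpace H] {I : ModelWithCorners ℝ E H}
  {G : Type*} [TopologicalSpace G] [ChartedSpace H G] [Group G]
  [LieGroup I (minSmoothness ℝ 3) G] [T2Space G] [BoundarylessManifold I G]
  {E' : Type*} [NormedAddCommGroup E'] [NormedSpace ℝ E']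
  {H' : Type*} [TopologicalSpace H'] {J : ModelWithCorners ℝ E' H'}
  {M : Type*} [TopologicalSpace M] [ChartedSpace H' M] [MulAction G M]
  {F : Type*} [NormedAddCommGroup F] [NormedSpace ℝ F] {u : M}

theorem infinitesimalGenerator_eq_mfderiv_smul
    (hact : MDifferentiableAt I J (fun g : G => g • u) 1) (v : GroupLieAlgebra I G) :
    @Eq E' (infinitesimalGenerator I J v u) (mfderiv I J (fun g : G => g • u) 1 v) := by
  have horbit := mfderiv_comp_apply_of_eq (g := fun g : G => g • u) (0 : ℝ) hact
    (hasMFDerivAt_lieExp_smul v).mdifferentiableAt (by rw [zero_smul, lieExp_zero]) (1 : ℝ)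
  exact horbit.trans (congrArg (mfderiv I J (fun g : G => g • u) 1)
    (mfderiv_lieExp_smul_zero_apply_one v))

theorem mvfderiv_infinitesimalGenerator {z : M → F} (hz : MDifferentiableAt J 𝓘(ℝ, F) z u)
    (hact : MDifferentiableAt I J (fun g : G => g • u) 1) (v : GroupLieAlgebra I G) :
    mvfderiv J z u (infinitesimalGenerator I J v u) = actionDeriv I G z u v :=
  (congrArg (mvfderiv J z u) (infinitesimalGenerator_eq_mfderiv_smul hact v)).trans
    (mfderiv_comp_apply_of_eq (g := z) (1 : G) hz hact (one_smul G u) v).symm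

end InfinitesimalGenerator

section PostLieIdentities

variable {E : Type*} [NormedAddCommGroup E] [NormedSpace ℝ E] [CompleteSpace E]
  {H : Type*} [TopologicalSpace H] {I : ModelWithCorners ℝ E H}
  {G : Type*} [TopologicalSpace G] [ChartedSpace H G] [Group G]
  [LieGroup I (minSmoothness ℝ 3) G] {M : Type*} [MulAction G M]
  {F : Type*} [NormedAddCommGroup F] [NormedSpace ℝ F] {x y : M → E} {z : M → F} {u : M}

theorem actionDeriv_apply_rightLieBracket_eq_associator_sub
    (hx : MDifferentiableAt I 𝓘(ℝ, E) (fun g : G => x (g • u)) 1)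
    (hy : MDifferentiableAt I 𝓘(ℝ, E) (fun g : G => y (g • u)) 1)
    (hz : ContMDiffAt I 𝓘(ℝ, F) 2 (fun g : G => z (g • u)) 1)
    (hDz : MDifferentiableAt I 𝓘(ℝ, E →L[ℝ] F) (fun g : G => actionDeriv I G z (g • u)) 1) :
    actionDeriv I G z u (rightLieBracketCLM I G (x u) (y u)) =
      (actionDeriv I G (fun p => actionDeriv I G z p (y p)) u (x u) -
          actionDeriv I G z u (actionDeriv I G y u (x u))) -
        (actionDeriv I G (fun p => actionDeriv I G z p (x p)) u (y u) -
          actionDeriv I G z u (actionDeriv I G x u (y u))) := by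
  refine ((congrArg (actionDeriv I G z u) (rightLieBracketCLM_apply I G (x u) (y u))).trans
    (actionDeriv_apply_rightLieBracket hz hDz (x u) (y u))).trans ?_
  rw [actionDeriv_actionDeriv_apply hDz hy, actionDeriv_actionDeriv_apply hDz hx,
    add_sub_cancel_left, add_sub_cancel_left]

end PostLieIdentities

section ActionProduct

variable {E : Type*} [NormedAddCommGroup E] [NormedSpace ℝ E]
  {H : Type*} [TopologicalSpace H] {I : ModelWithCorners ℝ E H}
  {G : Type*} [TopologicalSpace G] [ChartedSpace H G] [Group G]
  {E' : Type*} [NormedAddCommGroup E'] [NormedSpace ℝ E']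
  {H' : Type*} [TopologicalSpace H'] {J : ModelWithCorners ℝ E' H'}
  {M : Type*} [TopologicalSpace M] [ChartedSpace H' M] [MulAction G M]

theorem mdifferentiableAt_coe_comp_smul
    (hact : ContMDiff (I.prod J) J ∞ (fun p : G × M => p.1 • p.2))
    (x : smoothLieValued I G J M) (u : M) :
    MDifferentiableAt I 𝓘(ℝ, E) (M' := E) (fun g : G => x.1 (g • u)) 1 :=
  (contMDiffAt_comp_smul hact (x.2 u)).mdifferentiableAt (by simp)

variable [IsManifold I 1 G] [IsManifold J 1 M]

theorem contMDiff_actionDeriv_coe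
    (hact : ContMDiff (I.prod J) J ∞ (fun p : G × M => p.1 • p.2))
    (x : smoothLieValued I G J M) :
    ContMDiff J 𝓘(ℝ, E →L[ℝ] E) ∞ (actionDeriv I G (F := E) x.1) :=
  fun u => contMDiffAt_actionDeriv hact (by rfl) (x.2 u)

/-- The product `x ▷ y = λ_*(x)(y)` of smooth Lie algebra valued functions, with the Lie derivative
along `λ_*(x)` written as the derivative along orbits in the direction of `x`. -/
noncomputable def actionProduct (hact : ContMDiff (I.prod J) J ∞ (fun p : G × M => p.1 • p.2)) :
    smoothLieValued I G J M →ₗ[ℝ] smoothLieValued I G J M →ₗ[ℝ] smoothLieValued I G J M :=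
  LinearMap.mk₂ ℝ
    (fun x y => ⟨fun u => actionDeriv I G (F := E) y.1 u (x.1 u),
      (contMDiff_actionDeriv_coe hact y).clm_apply x.2⟩)
    (fun x x' y => Subtype.ext <| funext fun u =>
      (actionDeriv I G (F := E) y.1 u).map_add (x.1 u) (x'.1 u))
    (fun c x y => Subtype.ext <| funext fun u =>
      (actionDeriv I G (F := E) y.1 u).map_smul c (x.1 u))
    (fun x y y' => Subtype.ext <| funext fun u => DFunLike.congr_fun
      (actionDeriv_add (mdifferentiableAt_coe_comp_smul hact y u)
        (mdifferentiableAt_coe_comp_smul hact y' u)) (x.1 u))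
    (fun c x y => Subtype.ext <| funext fun u =>
      actionDeriv_clm_comp (c • ContinuousLinearMap.id ℝ E)
        (mdifferentiableAt_coe_comp_smul hact y u) (x.1 u))

theorem coe_actionProduct (hact : ContMDiff (I.prod J) J ∞ (fun p : G × M => p.1 • p.2))
    (x y : smoothLieValued I G J M) :
    @Eq (M → E) (actionProduct hact x y).1 (fun u => actionDeriv I G (F := E) y.1 u (x.1 u)) :=
  rfl

end ActionProduct

section PointwiseProducts

variable {E : Type*} [NormedAddCommGroup E] [NormedSpace ℝ E] [CompleteSpace E]
  {H : Type*} [TopologicalSpace H] {I : ModelWithCorners ℝ E H}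
  {G : Type*} [TopologicalSpace G] [ChartedSpace H G] [Group G]
  [LieGroup I (minSmoothness ℝ 3) G]
  {E' : Type*} [NormedAddCommGroup E'] [NormedSpace ℝ E']
  {H' : Type*} [TopologicalSpace H'] {J : ModelWithCorners ℝ E' H'}
  {M : Type*} [TopologicalSpace M] [ChartedSpace H' M]

theorem rightLieBracket_mem_smoothLieValued {x y : M → GroupLieAlgebra I G}
    (hx : x ∈ smoothLieValued I G J M) (hy : y ∈ smoothLieValued I G J M) :
    (fun u => rightLieBracket I (x u) (y u)) ∈ smoothLieValued I G J M := by
  have h : ContMDiff J 𝓘(ℝ, E) ∞ (fun u => rightLieBracketCLM I G (x u) (y u)) :=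
    ((rightLieBracketCLM I G).contMDiff.comp hx).clm_apply hy
  simp only [rightLieBracketCLM_apply] at h
  exact h

variable (I G J M) in
/-- The pointwise bracket of smooth Lie algebra valued functions, for the bracket of
right-invariant vector fields. -/
noncomputable def pointwiseBracket :
    smoothLieValued I G J M →ₗ[ℝ] smoothLieValued I G J M →ₗ[ℝ] smoothLieValued I G J M :=
  LinearMap.mk₂ ℝ
    (fun x y => ⟨fun u => rightLieBracket I (x.1 u) (y.1 u),
      rightLieBracket_mem_smoothLieValued x.2 y.2⟩)
    (fun _ _ _ => by ext; simp [rightLieBracket_eq_neg_lie, -lie_skew, add_comm])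
    (fun _ _ _ => by ext; simp [rightLieBracket_eq_neg_lie, -lie_skew])
    (fun _ _ _ => by ext; simp [rightLieBracket_eq_neg_lie, -lie_skew, add_comm])
    (fun _ _ _ => by ext; simp [rightLieBracket_eq_neg_lie, -lie_skew])

theorem coe_pointwiseBracket (x y : smoothLieValued I G J M) :
    @Eq (M → E) (pointwiseBracket I G J M x y).1
      (fun u => rightLieBracketCLM I G (x.1 u) (y.1 u)) :=
  funext fun u => (rightLieBracketCLM_apply I G (x.1 u) (y.1 u)).symm

variable [MulAction G M] [IsManifold J 1 M]

theorem actionProduct_pointwiseBracket_right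
    (hact : ContMDiff (I.prod J) J ∞ (fun p : G × M => p.1 • p.2))
    (x y z : smoothLieValued I G J M) :
    actionProduct hact x (pointwiseBracket I G J M y z) =
      pointwiseBracket I G J M (actionProduct hact x y) z +
        pointwiseBracket I G J M y (actionProduct hact x z) := by
  have hleibniz (u : M) := actionDeriv_bilinear (rightLieBracketCLM I G)
    (mdifferentiableAt_coe_comp_smul hact y u) (mdifferentiableAt_coe_comp_smul hact z u) (x.1 u)
  refine Subtype.ext ((coe_actionProduct hact x _).trans ?_)
  rw [Submodule.coe_add, coe_pointwiseBracket, coe_pointwiseBracket, coe_pointwiseBracket]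
  exact funext fun u => (hleibniz u).trans (add_comm (G := E) _ _)

theorem actionProduct_pointwiseBracket_left
    (hact : ContMDiff (I.prod J) J ∞ (fun p : G × M => p.1 • p.2))
    (x y z : smoothLieValued I G J M) :
    actionProduct hact (pointwiseBracket I G J M x y) z =
      (actionProduct hact x (actionProduct hact y z) -
          actionProduct hact (actionProduct hact x y) z) -
        (actionProduct hact y (actionProduct hact x z) -
          actionProduct hact (actionProduct hact y x) z) := by
  have hassoc (u : M) := actionDeriv_apply_rightLieBracket_eq_associator_sub
    (mdifferentiableAt_coe_comp_smul hact x u) (mdifferentiableAt_coe_comp_smul hact y u)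
    ((contMDiffAt_comp_smul hact (z.2 u)).of_le (by norm_cast))
    ((contMDiffAt_comp_smul hact
      (contMDiff_actionDeriv_coe hact z u)).mdifferentiableAt (by simp))
  refine Subtype.ext ((coe_actionProduct hact _ z).trans ?_)
  rw [coe_pointwiseBracket]
  exact funext hassoc

theorem isPostLieAlgebra_pointwiseBracket_actionProduct
    (hact : ContMDiff (I.prod J) J ∞ (fun p : G × M => p.1 • p.2)) :
    IsPostLieAlgebra (pointwiseBracket I G J M) (actionProduct hact) where
  lie_self _ := Subtype.ext <| funext fun _ => congrFun (mlieBracket_self (I := I)) (1 : G)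
  jacobi x y z := Subtype.ext <| funext fun u =>
    rightLieBracket_jacobi I G (x.1 u) (y.1 u) (z.1 u)
  tri_br := actionProduct_pointwiseBracket_right hact
  br_tri := actionProduct_pointwiseBracket_left hact

variable [T2Space G] [BoundarylessManifold I G]

theorem coe_actionProduct_eq_lieDerivAlong
    (hact : ContMDiff (I.prod J) J ∞ (fun p : G × M => p.1 • p.2))
    (x y : smoothLieValued I G J M) :
    (actionProduct hact x y).1 = lieDerivAlong I J (generatedField I J x.1) y.1 :=
  funext fun u => (mvfderiv_infinitesimalGenerator (ContMDiff.mdifferentiable y.2 (by simp) u)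
    ((hact.comp (contMDiff_id.prodMk contMDiff_const)).mdifferentiable (by simp) 1) (x.1 u)).symm

end PointwiseProducts

theorem mainTheorem6_general
    {E : Type*} [NormedAddCommGroup E] [NormedSpace ℝ E] [CompleteSpace E]
    {H : Type*} [TopologicalSpace H] (I : ModelWithCorners ℝ E H)
    {G : Type*} [TopologicalSpace G] [ChartedSpace H G] [Group G]
    [LieGroup I (minSmoothness ℝ 3) G] [T2Space G] [BoundarylessManifold I G]
    {E' : Type*} [NormedAddCommGroup E'] [NormedSpace ℝ E']
    {H' : Type*} [TopologicalSpace H'] (J : ModelWithCorners ℝ E' H')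
    {M : Type*} [TopologicalSpace M] [ChartedSpace H' M] [IsManifold J 1 M]
    [MulAction G M] (hact : ContMDiff (I.prod J) J ∞ (fun p : G × M => p.1 • p.2)) :
    ∃ brR brL tri : smoothLieValued I G J M →ₗ[ℝ]
        smoothLieValued I G J M →ₗ[ℝ] smoothLieValued I G J M,
      (∀ x y u, (brR x y).1 u = rightLieBracket I (x.1 u) (y.1 u)) ∧
      (∀ x y u, (brL x y).1 u = -⁅x.1 u, y.1 u⁆) ∧
      (∀ x y, (tri x y).1 = lieDerivAlong I J (generatedField I J x.1) y.1) ∧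
      IsPostLieAlgebra brR tri ∧ IsPostLieAlgebra brL tri :=
  have hpost := isPostLieAlgebra_pointwiseBracket_actionProduct hact
  ⟨pointwiseBracket I G J M, pointwiseBracket I G J M, actionProduct hact, fun _ _ _ => rfl,
    fun x y u => rightLieBracket_eq_neg_lie (x.1 u) (y.1 u),
    coe_actionProduct_eq_lieDerivAlong hact, hpost, hpost⟩

theorem mainTheorem6
    {E : Type*} [NormedAddCommGroup E] [NormedSpace ℝ E] [FiniteDimensional ℝ E]
    {H : Type*} [TopologicalSpace H] (I : ModelWithCorners ℝ E H)
    {G : Type*} [TopologicalSpace G] [ChartedSpace H G] [Group G] [LieGroup I ∞ G]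
    [T2Space G] [BoundarylessManifold I G]
    {E' : Type*} [NormedAddCommGroup E'] [NormedSpace ℝ E'] [FiniteDimensional ℝ E']
    {H' : Type*} [TopologicalSpace H'] (J : ModelWithCorners ℝ E' H')
    {M : Type*} [TopologicalSpace M] [ChartedSpace H' M] [IsManifold J ∞ M]
    [BoundarylessManifold J M]
    [MulAction G M] (hact : ContMDiff (I.prod J) J ∞ (fun p : G × M => p.1 • p.2)) :
    ∃ brR brL tri : smoothLieValued I G J M →ₗ[ℝ]
        smoothLieValued I G J M →ₗ[ℝ] smoothLieValued I G J M,
      (∀ x y u, (brR x y).1 u = rightLieBracket I (x.1 u) (y.1 u)) ∧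
      (∀ x y u, (brL x y).1 u = -⁅x.1 u, y.1 u⁆) ∧
      (∀ x y, (tri x y).1 = lieDerivAlong I J (generatedField I J x.1) y.1) ∧
      IsPostLieAlgebra brR tri ∧ IsPostLieAlgebra brL tri := by
  have : CompleteSpace E := FiniteDimensional.complete ℝ E
  have : LieGroup I (minSmoothness ℝ 3) G := LieGroup.of_le (n := ∞) <| by
    rw [minSmoothness_of_isRCLikeNormedField]
    exact WithTop.coe_le_coe.2 le_top
  exact mainTheorem6_general I J hact
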